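/- **Theorem (noiseless Max-Cut).** Let $G=(V,E)$ be a finite simple bipartite graph with $|V|=n$ vertices that is $D$-regular, $D\ge 1$. For a bit string $x\in\{0,1\}^V$ let $C(x)$ be the number of edges of $G$ whose endpoints have different labels in $x$, let $|x|$ be the Hamming weight of $x$, and let $C_{\max}=\max_x C(x)$. Put $h=\frac D2-\sqrt{D-1}$, and assume that $h>0$ (i.e. $D\neq 2$) and that $$C(x)\ \ge\ h\,\min\{|x|,\,n-|x|\}\qquad\text{for every }x\in\{0,1\}^V .$$ Let $H=\sum_{x}C(x)\,|x\rangle\langle x|=\frac12\sum_{\{j,k\}\in E}(\mathbb I-\sigma_z^j\sigma_z^k)$ be the Max-Cut Hamiltonian on the $n$ qubits labelled by $V$. 1. Let $\rho$ be the state obtained by applying to a tensor product input state $\rho_0=\bigotimes_{v\in V}\rho_v$ (with $\rho_v$ arbitrary one-qubit states) a circuit of $L$ layers, where each layer consists of unitary gates acting on mutually disjoint pairs of qubits. Assume that $\rho_0$ and every gate (tensored with the identity on the other qubits) commute with $\sigma_x^{\otimes n}$. If $$\operatorname{Tr}[\rho H]\ \ge\ C_{\max}\left(\frac56+\frac{\sqrt{D-1}}{3D}\right),$$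 then $$L\ \ge\ \frac12\log_2\frac n{576}.$$ 2. Let $\rho=U\,|+\rangle\langle+|^{\otimes n}\,U^\dagger$ be the output of the QAOA circuit of depth $P$, where $U=\prod_{k=1}^{P}e^{i\beta_kH_X}e^{i\gamma_kH_I}$ with arbitrary $\beta,\gamma\in\mathbb R^P$, $H_X=-\sum_{v\in V}\sigma_x^v$ and $H_I=-H$. If $\operatorname{Tr}[\rho H]\ge C_{\max}\left(\frac56+\frac{\sqrt{D-1}}{3D}\right)$, then $$P\ \ge\ \frac{1}{2\log(D+1)}\,\log\frac n{576}.$$ -/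

import Mathlib

open scoped ComplexOrder

noncomputable section

namespace QMaxCut

variable {V : Type*} [Fintype V] [DecidableEq V]

/-- Linear operators on the Hilbert space of qubits labelled by `V`, as matrices in the
computational basis, whose elements are the bit strings `V → Fin 2`. -/
abbrev Operator (V : Type*) := Matrix (V → Fin 2) (V → Fin 2) ℂ

/-- Density matrices: positive semidefinite with unit trace. -/
def IsState {m : Type*} [Fintype m] (ρ : Matrix m m ℂ) : Prop :=
  ρ.PosSemidef ∧ ρ.trace = 1

/-- The tensor product `⨂ v, A v` of one-qubit operators. -/
def tensorProd (A : V → Matrix (Fin 2) (Fin 2) ℂ) : Operator V :=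
  Matrix.of fun x y => ∏ v, A v (x v) (y v)

/-- `ρ` is a tensor product of one-qubit states. -/
def IsProductState (ρ : Operator V) : Prop :=
  ∃ σ : V → Matrix (Fin 2) (Fin 2) ℂ, (∀ v, IsState (σ v)) ∧ ρ = tensorProd σ

/-- The Pauli matrix `σ_x`. -/
def pauliX : Matrix (Fin 2) (Fin 2) ℂ := !![0, 1; 1, 0]

/-- The operator `σ_x^{⊗ n}`, which flips all the qubits. -/
def flipAll (V : Type*) [Fintype V] : Operator V := tensorProd fun _ => pauliX

/-- The operator acting as `A` on the qubit `v` and as the identity on the other qubits. -/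
def onQubit (v : V) (A : Matrix (Fin 2) (Fin 2) ℂ) : Operator V :=
  tensorProd (Function.update (fun _ => 1) v A)

/-- For a family `E` of disjoint sets of qubits, the operator `(⨂ e ∈ E, U e) ⊗ 𝟙`, where `U e`
acts on the qubits of `e` and `𝟙` is the identity on the qubits that lie in no element of `E`. -/
def gatesTensor (E : Finset (Finset V))
    (U : (e : Finset V) → Matrix (e → Fin 2) (e → Fin 2) ℂ) : Operator V :=
  Matrix.of fun x y =>
    (∏ e ∈ E, U e (fun i => x i) (fun i => y i)) *
      if ∀ v, (∀ e ∈ E, v ∉ e) → x v = y v then 1 else 0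

/-- A layer of a noiseless circuit: unitary gates acting on mutually disjoint sets of qubits.
Only the gates `gate e` with `e ∈ supports` are part of the layer. -/
structure UnitaryLayer (V : Type*) [DecidableEq V] where
  supports : Finset (Finset V)
  disjoint : (supports : Set (Finset V)).PairwiseDisjoint id
  gate : (e : Finset V) → Matrix (e → Fin 2) (e → Fin 2) ℂ
  unitary : ∀ e ∈ supports, gate e ∈ Matrix.unitaryGroup (e → Fin 2) ℂ

/-- The unitary implemented by the whole layer. -/
def UnitaryLayer.toOperator (ℓ : UnitaryLayer V) : Operator V :=
  gatesTensor ℓ.supports ℓ.gate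

/-- The gate on `e`, tensored with the identity on all the qubits outside `e`. -/
def UnitaryLayer.gateOperator (ℓ : UnitaryLayer V) (e : Finset V) : Operator V :=
  gatesTensor {e} ℓ.gate

/-- The output state of the circuit consisting of the given layers, the head of the list being
applied first; the depth of the circuit is the length of the list. -/
def circuitOutput (layers : List (UnitaryLayer V)) (ρ : Operator V) : Operator V :=
  layers.foldl (fun τ ℓ => ℓ.toOperator * τ * ℓ.toOperator.conjTranspose) ρ

/-- The cut `C(x)`: the number of edges of `G` whose endpoints have different labels in `x`. -/
def cut (G : SimpleGraph V) [DecidableRel G.Adj] (x : V → Fin 2) : ℕ :=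
  (G.edgeFinset.filter fun e => ¬ (e.map x).IsDiag).card

/-- The maximum cut of `G`. -/
def maxCut (G : SimpleGraph V) [DecidableRel G.Adj] : ℕ :=
  Finset.univ.sup (cut G)

/-- The Max-Cut Hamiltonian `H = ∑ x, C(x) |x⟩⟨x|`. -/
def maxCutHamiltonian (G : SimpleGraph V) [DecidableRel G.Adj] : Operator V :=
  Matrix.diagonal fun x => (cut G x : ℂ)

/-- The mixing Hamiltonian `H_X = - ∑ v, X_v`. -/
def mixer (V : Type*) [Fintype V] [DecidableEq V] : Operator V :=
  - ∑ v : V, onQubit v pauliX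

/-- The QAOA unitary `∏ k, exp (i β_k H_X) exp (i γ_k H_I)`, in the order in which the product is
written. The cost Hamiltonian `H_I`, to be minimised, is minus the Max-Cut Hamiltonian; another
normalisation, sign or additive constant only rescales the angles `γ_k` and adds a global phase. -/
def qaoaUnitary (G : SimpleGraph V) [DecidableRel G.Adj] {P : ℕ} (γ β : Fin P → ℝ) : Operator V :=
  (List.ofFn fun k : Fin P =>
    NormedSpace.exp ((Complex.I * (β k : ℂ)) • mixer V) *
      NormedSpace.exp ((Complex.I * (γ k : ℂ)) • (-maxCutHamiltonian G))).prod

/-- The density matrix of `|+⟩^{⊗ n}`. -/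
def plusState (V : Type*) [Fintype V] : Operator V :=
  tensorProd fun _ => !![1 / 2, 1 / 2; 1 / 2, 1 / 2]

/-- The output state of the QAOA circuit, applied to `|+⟩^{⊗ n}`. -/
def qaoaOutput (G : SimpleGraph V) [DecidableRel G.Adj] {P : ℕ} (γ β : Fin P → ℝ) : Operator V :=
  qaoaUnitary G γ β * plusState V * (qaoaUnitary G γ β).conjTranspose

end QMaxCut

end

noncomputable section

namespace QMaxCut

variable {V : Type*} [Fintype V]

/-! ### Tensor products of one-qubit operators -/

/-! Measure the output in the computational basis and let `S` be the sum of the spins, signed by the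
bipartition `ε`. Two estimates of the second moment of `S` contradict each other unless the circuit
is deep.

Lower bound (`variance_ge_of_energy`): every edge is cut by exactly one of `x` and `x + ε`, so the
maximum cut contains all edges, and the deficit of `x` is the cut of `x + ε`. By the expansion
hypothesis this deficit is at least `h (n - |S|) / 2`. The energy threshold allows a mean deficit of
exactly `h n / 6`, so `|S|` has mean at least `2n/3` and `S ^ 2` has mean at least `4n²/9`: the
output is concentrated near the two optimal cuts.

Upper bound (`IsProductState.output_variance_le`): the flip symmetry makes every spin have mean
zero, so spins with disjoint backward light cones are uncorrelated. If light cones have size at most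
`c` in both directions, each spin is correlated with at most `c²` others, itself included, and `S ^
2` has mean at most `n c²`.

Hence `n ≤ 9/4 c²` (`card_le_of_spreads`). Light-cone sizes multiply under composition
(`Spreads.mul`): a layer of two-qubit gates contributes a factor 2, and a QAOA step a factor `D +
1`. -/

lemma tensorProd_one : tensorProd (fun _ : V => (1 : Matrix (Fin 2) (Fin 2) ℂ)) = 1 := by
  ext x y
  simp only [tensorProd, Matrix.of_apply, Matrix.one_apply, Finset.prod_ite_zero,
    Finset.mem_univ, true_imp_iff, Finset.prod_const_one, funext_iff]

lemma conjTranspose_tensorProd (A : V → Matrix (Fin 2) (Fin 2) ℂ) :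
    (tensorProd A).conjTranspose = tensorProd fun v => (A v).conjTranspose := by
  ext x y
  simp [tensorProd, Matrix.conjTranspose_apply]

variable [DecidableEq V]

lemma tensorProd_mul (A B : V → Matrix (Fin 2) (Fin 2) ℂ) :
    tensorProd A * tensorProd B = tensorProd fun v => A v * B v := by
  ext x y
  simp only [tensorProd, Matrix.mul_apply, Matrix.of_apply, ← Finset.prod_mul_distrib,
    Finset.prod_univ_sum, Fintype.piFinset_univ]

lemma trace_tensorProd (A : V → Matrix (Fin 2) (Fin 2) ℂ) :
    (tensorProd A).trace = ∏ v, (A v).trace := by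
  simp only [tensorProd, Matrix.trace, Matrix.diag, Matrix.of_apply, Finset.prod_univ_sum,
    Fintype.piFinset_univ]

lemma tensorProd_commute {A B : V → Matrix (Fin 2) (Fin 2) ℂ} (h : ∀ v, Commute (A v) (B v)) :
    Commute (tensorProd A) (tensorProd B) := by
  simp only [Commute, SemiconjBy, tensorProd_mul, fun v => (h v).eq]

/-! ### Local operators -/

/-- The tensor products of one-qubit operators that are the identity outside `S`. -/
def localProducts (S : Finset V) : Submonoid (Operator V) where
  carrier := {T | ∃ A : V → Matrix (Fin 2) (Fin 2) ℂ, (∀ v ∉ S, A v = 1) ∧ T = tensorProd A}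
  one_mem' := ⟨fun _ => 1, fun _ _ => rfl, tensorProd_one.symm⟩
  mul_mem' := by
    rintro _ _ ⟨A, hA, rfl⟩ ⟨B, hB, rfl⟩
    exact ⟨_, fun v hv => by rw [hA v hv, hB v hv, one_mul], tensorProd_mul A B⟩

/-- The algebra of operators that act as the identity outside `S`. -/
def localAlgebra (S : Finset V) : Subalgebra ℂ (Operator V) :=
  Algebra.adjoin ℂ (localProducts S : Set (Operator V))

/-- Local products are already closed under multiplication, so the algebra they generate is their
linear span. This reduces linear statements about local operators to tensor products. -/
lemma mem_localAlgebra_iff {S : Finset V} {A : Operator V} :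
    A ∈ localAlgebra S ↔ A ∈ Submodule.span ℂ (localProducts S : Set (Operator V)) := by
  rw [localAlgebra, ← Subalgebra.mem_toSubmodule, Algebra.adjoin_eq_span, Submonoid.closure_eq]

lemma tensorProd_mem {S : Finset V} {A : V → Matrix (Fin 2) (Fin 2) ℂ} (hA : ∀ v ∉ S, A v = 1) :
    tensorProd A ∈ localAlgebra S :=
  Algebra.subset_adjoin ⟨A, hA, rfl⟩

lemma onQubit_mem {S : Finset V} {v : V} (hv : v ∈ S) (B : Matrix (Fin 2) (Fin 2) ℂ) :
    onQubit v B ∈ localAlgebra S := by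
  refine tensorProd_mem fun w hw => ?_
  rw [Function.update_of_ne]
  rintro rfl
  exact hw hv

lemma localAlgebra_mono {S T : Finset V} (h : S ⊆ T) : localAlgebra S ≤ localAlgebra T := by
  refine Algebra.adjoin_mono ?_
  rintro _ ⟨A, hA, rfl⟩
  exact ⟨A, fun v hv => hA v fun hS => hv (h hS), rfl⟩

lemma conjTranspose_mem {S : Finset V} {A : Operator V} (hA : A ∈ localAlgebra S) :
    A.conjTranspose ∈ localAlgebra S := by
  rw [mem_localAlgebra_iff] at hA
  induction hA using Submodule.span_induction with
  | mem A hA =>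
    obtain ⟨A, hA, rfl⟩ := hA
    rw [conjTranspose_tensorProd]
    exact tensorProd_mem fun v hv => by rw [hA v hv, Matrix.conjTranspose_one]
  | zero => simp
  | add A B _ _ hA hB => rw [Matrix.conjTranspose_add]; exact add_mem hA hB
  | smul c A _ hA => rw [Matrix.conjTranspose_smul]; exact Subalgebra.smul_mem _ hA _

lemma commute_of_disjoint {S T : Finset V} (hST : Disjoint S T) {A B : Operator V}
    (hA : A ∈ localAlgebra S) (hB : B ∈ localAlgebra T) : Commute A B := by
  refine Algebra.commute_of_mem_adjoin_of_forall_mem_commute hB ?_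
  rintro _ ⟨B, hB, rfl⟩
  refine (Algebra.commute_of_mem_adjoin_of_forall_mem_commute hA ?_).symm
  rintro _ ⟨A, hA, rfl⟩
  refine tensorProd_commute fun v => Commute.symm ?_
  by_cases hv : v ∈ S
  · rw [hB v (Finset.disjoint_left.1 hST hv)]; exact Commute.one_right _
  · rw [hA v hv]; exact Commute.one_left _

/-- Local operators with disjoint supports are uncorrelated in product states. -/
lemma IsProductState.trace_mul_mul {ρ : Operator V} (hρ : IsProductState ρ) {S T : Finset V}
    (hST : Disjoint S T) {A B : Operator V} (hA : A ∈ localAlgebra S) (hB : B ∈ localAlgebra T) :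
    (ρ * (A * B)).trace = (ρ * A).trace * (ρ * B).trace := by
  obtain ⟨σ, hσ, rfl⟩ := hρ
  rw [mem_localAlgebra_iff] at hA hB
  induction hA using Submodule.span_induction with
  | zero => simp
  | add A A' _ _ hA hA' => simp only [add_mul, mul_add, Matrix.trace_add, hA, hA']
  | smul c A _ hA =>
    simp only [Matrix.smul_mul, Matrix.mul_smul, Matrix.trace_smul, hA, smul_eq_mul, mul_assoc]
  | mem A hA =>
    obtain ⟨A, hA, rfl⟩ := hA
    induction hB using Submodule.span_induction with
    | zero => simp
    | add B B' _ _ hB hB' => simp only [mul_add, Matrix.trace_add, hB, hB']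
    | smul c B _ hB =>
      simp only [Matrix.mul_smul, Matrix.trace_smul, hB, smul_eq_mul, mul_left_comm]
    | mem B hB =>
      obtain ⟨B, hB, rfl⟩ := hB
      simp only [tensorProd_mul, trace_tensorProd, ← Finset.prod_mul_distrib]
      refine Finset.prod_congr rfl fun v _ => ?_
      by_cases hv : v ∈ S
      · rw [hB v (Finset.disjoint_left.1 hST hv), mul_one, mul_one, (hσ v).2, mul_one]
      · rw [hA v hv, one_mul, mul_one, (hσ v).2, one_mul]

lemma gatesTensor_singleton_apply (e : Finset V)
    (U : (e : Finset V) → Matrix (e → Fin 2) (e → Fin 2) ℂ) (x y : V → Fin 2) :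
    gatesTensor {e} U x y =
      U e (fun i => x i) (fun i => y i) * if ∀ v ∉ e, x v = y v then 1 else 0 := by
  simp [gatesTensor]

/-- A gate on `e` is a local operator. -/
lemma gatesTensor_singleton_mem (e : Finset V)
    (U : (e : Finset V) → Matrix (e → Fin 2) (e → Fin 2) ℂ) :
    gatesTensor {e} U ∈ localAlgebra e := by
  -- Expand the gate in matrix units; each matrix unit on `e` is a tensor product of one-qubit
  -- matrix units.
  have key : gatesTensor {e} U = ∑ a : e → Fin 2, ∑ b : e → Fin 2, U e a b •
      tensorProd fun v => if h : v ∈ e then Matrix.single (a ⟨v, h⟩) (b ⟨v, h⟩) 1 else 1 := by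
    ext x y
    have hprod : ∀ a b : e → Fin 2,
        tensorProd (fun v => if h : v ∈ e then
          Matrix.single (a ⟨v, h⟩) (b ⟨v, h⟩) (1 : ℂ) else 1) x y =
        if (a = fun i : e => x i) ∧ b = fun i : e => y i then
          (if ∀ v ∉ e, x v = y v then 1 else 0) else 0 := by
      intro a b
      have : ∀ v, (if h : v ∈ e then Matrix.single (a ⟨v, h⟩) (b ⟨v, h⟩) (1 : ℂ) else 1)
          (x v) (y v) = if (∀ h : v ∈ e, a ⟨v, h⟩ = x v ∧ b ⟨v, h⟩ = y v) ∧
            (v ∉ e → x v = y v) then 1 else 0 := by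
        intro v
        by_cases h : v ∈ e <;> simp [h, Matrix.single_apply, Matrix.one_apply]
      simp only [tensorProd, Matrix.of_apply, this, Finset.prod_ite_zero, Finset.prod_const_one,
        ← ite_and]
      congr 1
      simp only [Finset.mem_univ, true_imp_iff, funext_iff, Subtype.forall, eq_iff_iff]
      grind
    simp only [Matrix.sum_apply, Matrix.smul_apply, hprod, gatesTensor_singleton_apply, ite_and,
      smul_eq_mul, mul_ite, mul_zero, Finset.sum_ite_eq', Finset.mem_univ, if_true, mul_one,
      Finset.sum_ite_irrel, Finset.sum_const_zero]
  rw [key]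
  refine sum_mem fun a _ => sum_mem fun b _ => Subalgebra.smul_mem _ (tensorProd_mem ?_) _
  intro v hv
  simp [hv]

/-- A diagonal operator that depends only on the qubits of `S` is local. -/
lemma diagonal_mem {S : Finset V} {f : (V → Fin 2) → ℂ}
    (hf : ∀ x y, (∀ v ∈ S, x v = y v) → f x = f y) : Matrix.diagonal f ∈ localAlgebra S := by
  classical
  have : Matrix.diagonal f = gatesTensor {S} fun e => Matrix.diagonal fun a : e → Fin 2 =>
      f fun v => if h : v ∈ e then a ⟨v, h⟩ else 0 := by
    ext x y
    rw [gatesTensor_singleton_apply]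
    by_cases hxy : x = y
    · subst hxy
      simp only [Matrix.diagonal_apply_eq, implies_true, if_true, mul_one]
      exact hf _ _ fun v hv => by simp [hv]
    · rw [Matrix.diagonal_apply_ne _ hxy]
      by_cases h : ∀ v ∉ S, x v = y v
      · rw [Matrix.diagonal_apply_ne, zero_mul]
        intro h'
        exact hxy (funext fun v => if hv : v ∈ S then congrFun h' ⟨v, hv⟩ else h v hv)
      · rw [if_neg h, mul_zero]
  rw [this]
  exact gatesTensor_singleton_mem S _

/-! ### Light cones -/

lemma conjTranspose_mul_self_of_mem {W : Operator V}
    (hW : W ∈ Matrix.unitaryGroup (V → Fin 2) ℂ) : W.conjTranspose * W = 1 :=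
  Matrix.mem_unitaryGroup_iff'.1 hW

lemma mul_conjTranspose_self_of_mem {W : Operator V}
    (hW : W ∈ Matrix.unitaryGroup (V → Fin 2) ℂ) : W * W.conjTranspose = 1 :=
  Matrix.mem_unitaryGroup_iff.1 hW

/-- In the Heisenberg picture, `W` maps every one-qubit operator to an operator on at most `c`
qubits, and every qubit is reached from at most `c` qubits. -/
def Spreads (W : Operator V) (c : ℕ) : Prop :=
  ∃ N : V → Finset V,
    (∀ v B, W.conjTranspose * onQubit v B * W ∈ localAlgebra (N v)) ∧
    (∀ v, (N v).card ≤ c) ∧ ∀ w, (Finset.univ.filter fun v => w ∈ N v).card ≤ c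

lemma conj_mul {W : Operator V} (hW : W ∈ Matrix.unitaryGroup (V → Fin 2) ℂ) (A B : Operator V) :
    W.conjTranspose * (A * B) * W =
      (W.conjTranspose * A * W) * (W.conjTranspose * B * W) := by
  calc W.conjTranspose * (A * B) * W = W.conjTranspose * A * 1 * B * W := by
        simp only [mul_one, mul_assoc]
    _ = _ := by rw [← mul_conjTranspose_self_of_mem hW]; simp only [mul_assoc]

/-- Factors that commute with an observable do not affect its evolution. -/
lemma conj_mul_of_commute {R G A : Operator V} (hR : R ∈ Matrix.unitaryGroup (V → Fin 2) ℂ)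
    (hA : Commute R A) : (R * G).conjTranspose * A * (R * G) = G.conjTranspose * A * G := by
  calc (R * G).conjTranspose * A * (R * G)
      = G.conjTranspose * (R.conjTranspose * (A * R)) * G := by
        simp only [Matrix.conjTranspose_mul, mul_assoc]
    _ = G.conjTranspose * A * G := by
        rw [← hA.eq, ← mul_assoc R.conjTranspose, conjTranspose_mul_self_of_mem hR, one_mul]

/-- Conjugation by a unitary is multiplicative, so a tensor product can be evolved one factor at a
time: the light cone of a set is the union of the light cones of its points. -/
lemma conj_mem {W : Operator V} (hW : W ∈ Matrix.unitaryGroup (V → Fin 2) ℂ) {N : V → Finset V}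
    (hN : ∀ v B, W.conjTranspose * onQubit v B * W ∈ localAlgebra (N v)) {S : Finset V}
    {A : Operator V} (hA : A ∈ localAlgebra S) :
    W.conjTranspose * A * W ∈ localAlgebra (S.biUnion N) := by
  have key : ∀ (S : Finset V) (A : V → Matrix (Fin 2) (Fin 2) ℂ), (∀ v ∉ S, A v = 1) →
      W.conjTranspose * tensorProd A * W ∈ localAlgebra (S.biUnion N) := by
    intro S
    induction S using Finset.induction_on with
    | empty =>
      intro A hA
      obtain rfl : A = fun _ => 1 := funext fun v => hA v (Finset.notMem_empty v)
      rw [tensorProd_one, mul_one, conjTranspose_mul_self_of_mem hW]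
      exact one_mem _
    | insert v S hv ih =>
      intro A hA
      have hsplit : tensorProd A = onQubit v (A v) * tensorProd (Function.update A v 1) := by
        rw [onQubit, tensorProd_mul]
        congr 1
        ext1 w
        by_cases hw : w = v
        · subst hw; simp
        · simp [hw]
      rw [hsplit, conj_mul hW, Finset.biUnion_insert]
      refine mul_mem (localAlgebra_mono Finset.subset_union_left (hN v _))
        (localAlgebra_mono Finset.subset_union_right (ih _ fun w hw => ?_))
      by_cases hwv : w = v
      · subst hwv; simp
      · rw [Function.update_of_ne hwv]
        exact hA w (by simp [hwv, hw])
  rw [mem_localAlgebra_iff] at hA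
  induction hA using Submodule.span_induction with
  | mem A hA =>
    obtain ⟨A, hA, rfl⟩ := hA
    exact key S A hA
  | zero => simp
  | add A B _ _ hA hB => rw [mul_add, add_mul]; exact add_mem hA hB
  | smul c A _ hA =>
    rw [Matrix.mul_smul, Matrix.smul_mul]
    exact Subalgebra.smul_mem _ hA _

lemma Spreads.one : Spreads (1 : Operator V) 1 := by
  refine ⟨fun v => {v}, fun v B => ?_, by simp, fun w => ?_⟩
  · rw [Matrix.conjTranspose_one, one_mul, mul_one]
    exact onQubit_mem (Finset.mem_singleton_self v) B
  · simp only [Finset.mem_singleton]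
    exact Finset.card_le_one.2 (by simp +contextual)

/-- In the Heisenberg picture `W₁` acts on the observable before `W₂`, so the new cone is the
`N₂`-cone of the `N₁`-cone. The reverse cones compose in the opposite order, whence the swap of
factors in the last bound. -/
lemma Spreads.mul {W₁ W₂ : Operator V} {c₁ c₂ : ℕ}
    (hW₂ : W₂ ∈ Matrix.unitaryGroup (V → Fin 2) ℂ) (h₁ : Spreads W₁ c₁) (h₂ : Spreads W₂ c₂) :
    Spreads (W₁ * W₂) (c₁ * c₂) := by
  obtain ⟨N₁, hN₁, hc₁, hd₁⟩ := h₁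
  obtain ⟨N₂, hN₂, hc₂, hd₂⟩ := h₂
  refine ⟨fun v => (N₁ v).biUnion N₂, fun v B => ?_, fun v => ?_, fun w => ?_⟩
  · have := conj_mem hW₂ hN₂ (hN₁ v B)
    rwa [← mul_assoc, ← mul_assoc, ← Matrix.conjTranspose_mul, mul_assoc _ W₁ W₂] at this
  · exact (Finset.card_biUnion_le_card_mul _ _ _ fun u _ => hc₂ u).trans
      (Nat.mul_le_mul_right _ (hc₁ v))
  · have : (Finset.univ.filter fun v => w ∈ (N₁ v).biUnion N₂) =
        (Finset.univ.filter fun u => w ∈ N₂ u).biUnion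
          fun u => Finset.univ.filter fun v => u ∈ N₁ v := by
      ext v
      simp [and_comm]
    rw [this, mul_comm]
    exact (Finset.card_biUnion_le_card_mul _ _ _ fun u _ => hd₁ u).trans
      (Nat.mul_le_mul_right _ (hd₂ w))

/-! ### Layers of gates -/

lemma gatesTensor_empty (U : (e : Finset V) → Matrix (e → Fin 2) (e → Fin 2) ℂ) :
    gatesTensor ∅ U = 1 := by
  ext x y
  simp [gatesTensor, Matrix.one_apply, funext_iff]

lemma gatesTensor_insert {e : Finset V} {E : Finset (Finset V)} (he : e ∉ E)
    (hdisj : ∀ e' ∈ E, Disjoint e e') (U : (e : Finset V) → Matrix (e → Fin 2) (e → Fin 2) ℂ) :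
    gatesTensor (insert e E) U = gatesTensor {e} U * gatesTensor E U := by
  ext x y
  have hE : ∀ v ∈ e, ∀ e' ∈ E, v ∉ e' := fun v hv e' he' =>
    Finset.disjoint_left.1 (hdisj e' he') hv
  -- Only one intermediate string contributes: the first factor fixes it off `e`, and the second
  -- fixes it on `e` because no other support meets `e`.
  rw [Matrix.mul_apply, Finset.sum_eq_single fun v => if v ∈ e then y v else x v]
  · have h1 : ∏ e' ∈ E, U e' (fun i => if (i : V) ∈ e then y i else x i) (fun i => y i) =
        ∏ e' ∈ E, U e' (fun i => x i) (fun i => y i) := by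
      refine Finset.prod_congr rfl fun e' he' => ?_
      congr 2
      ext1 i
      rw [if_neg fun h => hE i h e' he' i.2]
    have h2 : (∀ v, (∀ e' ∈ E, v ∉ e') → (if v ∈ e then y v else x v) = y v) ↔
        ∀ v, (∀ e' ∈ insert e E, v ∉ e') → x v = y v := by
      simp only [Finset.forall_mem_insert]
      exact forall_congr' fun v => by by_cases hv : v ∈ e <;> simp [hv]
    rw [gatesTensor_singleton_apply, if_pos (fun v hv => by simp [hv])]
    simp only [gatesTensor, Matrix.of_apply, Finset.prod_insert he, h1, h2, mul_one]
    simp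
  · intro z _ hz
    rw [gatesTensor_singleton_apply]
    by_cases h1 : ∀ v ∉ e, x v = z v
    · have h2 : ¬ ∀ v, (∀ e' ∈ E, v ∉ e') → z v = y v := by
        intro h2
        refine hz (funext fun v => ?_)
        by_cases hv : v ∈ e
        · simp [hv, h2 v (hE v hv)]
        · simp [hv, h1 v hv]
      simp [gatesTensor, h2]
    · simp [h1]
  · simp

lemma gatesTensor_singleton_mul (e : Finset V)
    (U U' : (e : Finset V) → Matrix (e → Fin 2) (e → Fin 2) ℂ) :
    gatesTensor {e} U * gatesTensor {e} U' = gatesTensor {e} fun e => U e * U' e := by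
  ext x y
  simp only [Matrix.mul_apply, gatesTensor_singleton_apply, Finset.sum_mul]
  symm
  refine Fintype.sum_of_injective
    (fun (a : e → Fin 2) v => if h : v ∈ e then a ⟨v, h⟩ else x v) ?_ _ _ ?_ ?_
  · intro a b hab
    ext1 i
    simpa using congrFun hab i
  · intro z hz
    rw [if_neg, mul_zero, zero_mul]
    intro h
    refine hz ⟨fun i => z i, funext fun v => ?_⟩
    by_cases hv : v ∈ e
    · simp [hv]
    · simp [hv, h v hv]
  · intro a
    have h : (∀ v ∉ e, (if h : v ∈ e then a ⟨v, h⟩ else x v) = y v) ↔ ∀ v ∉ e, x v = y v :=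
      forall₂_congr fun v hv => by simp [hv]
    have h' : ∀ v ∉ e, x v = if h : v ∈ e then a ⟨v, h⟩ else x v := fun v hv => by simp [hv]
    simp only [h, if_pos h', mul_one, ← mul_assoc]
    simp

lemma gatesTensor_singleton_mem_unitaryGroup {e : Finset V}
    {U : (e : Finset V) → Matrix (e → Fin 2) (e → Fin 2) ℂ}
    (hU : U e ∈ Matrix.unitaryGroup (e → Fin 2) ℂ) :
    gatesTensor {e} U ∈ Matrix.unitaryGroup (V → Fin 2) ℂ := by
  have hstar : (gatesTensor {e} U).conjTranspose =
      gatesTensor {e} fun e => (U e).conjTranspose := by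
    ext x y
    have h : (∀ v ∉ e, y v = x v) ↔ ∀ v ∉ e, x v = y v := forall₂_congr fun v _ => eq_comm
    simp only [Matrix.conjTranspose_apply, gatesTensor_singleton_apply, h]
    split_ifs <;> simp
  rw [Matrix.mem_unitaryGroup_iff, Matrix.star_eq_conjTranspose, hstar, gatesTensor_singleton_mul]
  ext x y
  rw [gatesTensor_singleton_apply, ← Matrix.star_eq_conjTranspose,
    Matrix.mem_unitaryGroup_iff.1 hU, Matrix.one_apply, Matrix.one_apply, mul_ite, mul_one, mul_zero,
    ← ite_and]
  refine if_congr ?_ rfl rfl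
  simp only [funext_iff, Subtype.forall]
  rw [and_comm]
  exact ⟨fun h v => by by_cases hv : v ∈ e; exacts [h.1 v hv, h.2 v hv],
    fun h => ⟨fun v _ => h v, fun v _ => h v⟩⟩

section Family

variable {E : Finset (Finset V)} {U : (e : Finset V) → Matrix (e → Fin 2) (e → Fin 2) ℂ}

/-- A layer is the product of its gates, so it inherits any property closed under products; this
serves locality, unitarity and commutation with the flip. -/
lemma gatesTensor_induction (hdisj : (E : Set (Finset V)).PairwiseDisjoint id)
    {M : Submonoid (Operator V)} (h : ∀ e ∈ E, gatesTensor {e} U ∈ M) : gatesTensor E U ∈ M := by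
  induction E using Finset.induction_on with
  | empty => rw [gatesTensor_empty]; exact one_mem _
  | insert e E he ih =>
    rw [gatesTensor_insert he fun e' he' => hdisj (by simp) (by simp [he']) fun h => he (h ▸ he')]
    exact mul_mem (h e (by simp)) (ih (hdisj.subset (by simp)) fun e' he' => h e' (by simp [he']))

lemma gatesTensor_mem (hdisj : (E : Set (Finset V)).PairwiseDisjoint id) :
    gatesTensor E U ∈ localAlgebra (E.biUnion id) :=
  gatesTensor_induction (M := (localAlgebra (E.biUnion id)).toSubmonoid) hdisj fun e he =>
    localAlgebra_mono (Finset.subset_biUnion_of_mem id he) (gatesTensor_singleton_mem e U)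

lemma gatesTensor_mem_unitaryGroup (hdisj : (E : Set (Finset V)).PairwiseDisjoint id)
    (hU : ∀ e ∈ E, U e ∈ Matrix.unitaryGroup (e → Fin 2) ℂ) :
    gatesTensor E U ∈ Matrix.unitaryGroup (V → Fin 2) ℂ :=
  gatesTensor_induction hdisj fun e he => gatesTensor_singleton_mem_unitaryGroup (hU e he)

end Family

lemma UnitaryLayer.toOperator_mem (ℓ : UnitaryLayer V) :
    ℓ.toOperator ∈ Matrix.unitaryGroup (V → Fin 2) ℂ :=
  gatesTensor_mem_unitaryGroup ℓ.disjoint ℓ.unitary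

lemma UnitaryLayer.toOperator_commute (ℓ : UnitaryLayer V) {F : Operator V}
    (h : ∀ e ∈ ℓ.supports, Commute (ℓ.gateOperator e) F) : Commute ℓ.toOperator F :=
  (gatesTensor_induction (M := Submonoid.centralizer {F}) ℓ.disjoint fun e he =>
    Submonoid.mem_centralizer_iff.2 fun _ hF => hF ▸ (h e he).symm.eq :
      gatesTensor ℓ.supports ℓ.gate ∈ Submonoid.centralizer {F}) F rfl |>.symm

/-- A layer of gates on disjoint sets of at most `c` qubits spreads operators to `c` qubits. -/
lemma UnitaryLayer.spreads (ℓ : UnitaryLayer V) {c : ℕ} (hc : 1 ≤ c)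
    (h : ∀ e ∈ ℓ.supports, e.card ≤ c) : Spreads ℓ.toOperator c := by
  -- The cone of `v` is the support of the gate containing `v`, or `{v}` if no gate acts on it.
  let N : V → Finset V := fun v =>
    Finset.univ.filter fun w => w = v ∨ ∃ e ∈ ℓ.supports, v ∈ e ∧ w ∈ e
  have hsub : ∀ e ∈ ℓ.supports, ∀ v ∈ e, N v = e := by
    intro e he v hv
    ext w
    simp only [N, Finset.mem_filter, Finset.mem_univ, true_and]
    constructor
    · rintro (rfl | ⟨e', he', hv', hw⟩)
      · exact hv
      · rwa [ℓ.disjoint.elim_finset he he' v hv hv']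
    · exact fun hw => Or.inr ⟨e, he, hv, hw⟩
  have hcard : ∀ v, (N v).card ≤ c := by
    intro v
    by_cases hv : ∃ e ∈ ℓ.supports, v ∈ e
    · obtain ⟨e, he, hv⟩ := hv
      rw [hsub e he v hv]
      exact h e he
    · refine (Finset.card_le_one.2 fun a ha b hb => ?_).trans hc
      simp only [N, Finset.mem_filter, Finset.mem_univ, true_and] at ha hb
      grind
  refine ⟨N, fun v B => ?_, hcard, fun w => ?_⟩
  · by_cases hv : ∃ e ∈ ℓ.supports, v ∈ e
    · obtain ⟨e, he, hv⟩ := hv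
      have hdisj : ∀ e' ∈ ℓ.supports.erase e, Disjoint e e' := fun e' he' =>
        ℓ.disjoint he (Finset.mem_of_mem_erase he') (Finset.ne_of_mem_erase he').symm
      have hdisj' : ((ℓ.supports.erase e : Finset (Finset V)) : Set (Finset V)).PairwiseDisjoint
          id := ℓ.disjoint.subset (by simp)
      have hR : gatesTensor (ℓ.supports.erase e) ℓ.gate ∈
          localAlgebra ((ℓ.supports.erase e).biUnion id) := gatesTensor_mem hdisj'
      have hG : gatesTensor {e} ℓ.gate ∈ localAlgebra e := gatesTensor_singleton_mem e ℓ.gate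
      have hB : onQubit v B ∈ localAlgebra e := onQubit_mem hv B
      have he' : Disjoint ((ℓ.supports.erase e).biUnion id) e :=
        (Finset.disjoint_biUnion_right _ _ _).2 hdisj |>.symm
      -- Write the layer with the gate on `e` rightmost; the other gates then meet the observable
      -- first and cancel.
      rw [UnitaryLayer.toOperator, ← Finset.insert_erase he,
        gatesTensor_insert (Finset.notMem_erase _ _) hdisj, ← (commute_of_disjoint he' hR hG).eq,
        conj_mul_of_commute (gatesTensor_mem_unitaryGroup hdisj' fun e' he' =>
          ℓ.unitary e' (Finset.mem_of_mem_erase he')) (commute_of_disjoint he' hR hB),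
        hsub e he v hv]
      exact mul_mem (mul_mem (conjTranspose_mem hG) hB) hG
    · have hvE : Disjoint (ℓ.supports.biUnion id) {v} := by
        simpa [Finset.disjoint_singleton_right] using hv
      have hB := onQubit_mem (Finset.mem_singleton_self v) B
      have hcomm : Commute ℓ.toOperator (onQubit v B) :=
        commute_of_disjoint hvE (gatesTensor_mem ℓ.disjoint) hB
      rw [← mul_one ℓ.toOperator, conj_mul_of_commute ℓ.toOperator_mem hcomm]
      refine localAlgebra_mono (S := {v}) (by simp [N]) ?_
      simpa using hB
  · refine le_trans (Finset.card_le_card fun v hv => ?_) (hcard w)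
    simp only [N, Finset.mem_filter, Finset.mem_univ, true_and] at hv ⊢
    grind

/-! ### Correlations of the output -/

/-- The eigenvalue of `σ_z` on a computational basis state. -/
def spin (b : Fin 2) : ℝ := if b = 0 then 1 else -1

lemma spin_add (a b : Fin 2) : spin (a + b) = spin a * spin b := by
  fin_cases a <;> fin_cases b <;> simp [spin]

lemma abs_spin (a : Fin 2) : |spin a| = 1 := by
  fin_cases a <;> simp [spin]

lemma onQubit_diagonal (v : V) (d : Fin 2 → ℂ) :
    onQubit v (Matrix.diagonal d) = Matrix.diagonal fun x => d (x v) := by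
  ext x y
  by_cases hxy : x = y
  · subst hxy
    rw [Matrix.diagonal_apply_eq, onQubit, tensorProd, Matrix.of_apply,
      Finset.prod_eq_single v (fun w _ hw => by rw [Function.update_of_ne hw, Matrix.one_apply_eq])
        (fun h => absurd (Finset.mem_univ v) h), Function.update_self, Matrix.diagonal_apply_eq]
  · rw [Matrix.diagonal_apply_ne _ hxy]
    obtain ⟨w, hw⟩ := Function.ne_iff.1 hxy
    refine Finset.prod_eq_zero (Finset.mem_univ w) ?_
    by_cases hwv : w = v
    · subst hwv; rw [Function.update_self, Matrix.diagonal_apply_ne _ hw]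
    · rw [Function.update_of_ne hwv, Matrix.one_apply_ne hw]

open scoped MatrixOrder Matrix.Norms.L2Operator in
-- Factor each one-qubit state as `star B * B`; the tensor product of these factorisations is again
-- one.
lemma IsProductState.posSemidef {ρ : Operator V} (hρ : IsProductState ρ) : ρ.PosSemidef := by
  obtain ⟨σ, hσ, rfl⟩ := hρ
  choose B hB using fun v => CStarAlgebra.nonneg_iff_eq_star_mul_self.1 (hσ v).1.nonneg
  have : tensorProd σ = (tensorProd B).conjTranspose * tensorProd B := by
    rw [conjTranspose_tensorProd, tensorProd_mul]
    congr 1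
    exact funext hB
  rw [this]
  exact Matrix.posSemidef_conjTranspose_mul_self _

lemma IsProductState.trace_eq_one {ρ : Operator V} (hρ : IsProductState ρ) : ρ.trace = 1 := by
  obtain ⟨σ, hσ, rfl⟩ := hρ
  rw [trace_tensorProd]
  exact Finset.prod_eq_one fun v _ => (hσ v).2

lemma flipAll_mul_self : flipAll V * flipAll V = 1 := by
  rw [flipAll, tensorProd_mul, ← tensorProd_one]
  congr 1
  ext1 v
  ext i j
  fin_cases i <;> fin_cases j <;> simp [pauliX]

omit [DecidableEq V] in
lemma conjTranspose_flipAll : (flipAll V).conjTranspose = flipAll V := by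
  rw [flipAll, conjTranspose_tensorProd]
  congr 1
  ext1 v
  ext i j
  fin_cases i <;> fin_cases j <;> simp [pauliX]

/-- A nonzero entry of the flip joins strings that differ at every qubit, hence with opposite spins
at `v`. -/
lemma flipAll_mul_diagonal_spin (v : V) :
    flipAll V * Matrix.diagonal (fun x => (spin (x v) : ℂ)) =
      - (Matrix.diagonal (fun x => (spin (x v) : ℂ)) * flipAll V) := by
  ext x y
  rw [Matrix.mul_diagonal, Matrix.neg_apply, Matrix.diagonal_mul]
  by_cases h : x v = y v
  · have : flipAll V x y = 0 := by
      refine Finset.prod_eq_zero (Finset.mem_univ v) ?_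
      rw [h]
      generalize y v = b
      fin_cases b <;> simp [pauliX]
    simp [this]
  · have : spin (x v) = - spin (y v) := by
      revert h
      generalize x v = a, y v = b
      fin_cases a <;> fin_cases b <;> simp [spin]
    rw [this]
    push_cast
    ring

lemma trace_mul_diagonal_spin {ρ : Operator V} (hρ : Commute ρ (flipAll V)) (v : V) :
    (ρ * Matrix.diagonal fun x : V → Fin 2 => (spin (x v) : ℂ)).trace = 0 := by
  set Z : Operator V := Matrix.diagonal (fun x => (spin (x v) : ℂ))
  have h : (ρ * Z).trace = -(ρ * Z).trace := by
    -- Insert the square of the flip and carry one copy around the trace; anticommuting the flip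
    -- past `Z` costs the sign.
    calc (ρ * Z).trace = (flipAll V * (flipAll V * ρ * Z)).trace := by
          rw [mul_assoc, ← mul_assoc, flipAll_mul_self, one_mul]
      _ = (ρ * (flipAll V * Z) * flipAll V).trace := by
          rw [Matrix.trace_mul_comm, ← hρ.eq]; simp only [mul_assoc]
      _ = -(ρ * Z).trace := by
          rw [flipAll_mul_diagonal_spin, Matrix.mul_neg, Matrix.neg_mul, Matrix.trace_neg,
            mul_assoc, mul_assoc, flipAll_mul_self, mul_one]
  exact self_eq_neg.1 h

lemma trace_mul_diagonal (ρ : Operator V) (f : (V → Fin 2) → ℝ) :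
    (ρ * Matrix.diagonal fun x => (f x : ℂ)).trace.re = ∑ x, (ρ x x).re * f x := by
  simp [Matrix.trace, Matrix.mul_diagonal]

lemma IsProductState.output_nonneg {ρ₀ : Operator V} (hρ₀ : IsProductState ρ₀)
    (W : Operator V) (x : V → Fin 2) :
    0 ≤ ((W * ρ₀ * W.conjTranspose) x x).re :=
  (Complex.nonneg_iff.1 (hρ₀.posSemidef.mul_mul_conjTranspose_same W).diag_nonneg).1

lemma IsProductState.sum_output {W ρ₀ : Operator V}
    (hW : W ∈ Matrix.unitaryGroup (V → Fin 2) ℂ) (hρ₀ : IsProductState ρ₀) :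
    ∑ x, ((W * ρ₀ * W.conjTranspose) x x).re = 1 := by
  have : (W * ρ₀ * W.conjTranspose).trace = 1 := by
    rw [Matrix.trace_mul_comm, ← mul_assoc, conjTranspose_mul_self_of_mem hW, one_mul,
      hρ₀.trace_eq_one]
  simpa [Matrix.trace] using congrArg Complex.re this

/-- Spins whose light cones are disjoint are uncorrelated in the output. -/
lemma IsProductState.trace_output_mul {W ρ₀ : Operator V}
    (hW : W ∈ Matrix.unitaryGroup (V → Fin 2) ℂ) (hρ₀ : IsProductState ρ₀)
    (hflip : Commute ρ₀ (flipAll V))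
    (hWflip : Commute W (flipAll V)) {N : V → Finset V}
    (hN : ∀ v B, W.conjTranspose * onQubit v B * W ∈ localAlgebra (N v)) {j k : V}
    (hjk : Disjoint (N j) (N k)) :
    ∑ x, ((W * ρ₀ * W.conjTranspose) x x).re * (spin (x j) * spin (x k)) = 0 := by
  have hcomm : Commute (W * ρ₀ * W.conjTranspose) (flipAll V) := by
    refine (hWflip.mul_left hflip).mul_left ?_
    have := congrArg Matrix.conjTranspose hWflip.eq
    rw [Matrix.conjTranspose_mul, Matrix.conjTranspose_mul, conjTranspose_flipAll] at this
    exact this.symm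
  let Z : V → Operator V := fun v => onQubit v (Matrix.diagonal fun b => (spin b : ℂ))
  have hZ : ∀ v, Z v = Matrix.diagonal fun x => (spin (x v) : ℂ) := fun v => onQubit_diagonal _ _
  have hφ : ∀ A : Operator V, (W * ρ₀ * W.conjTranspose * A).trace =
      (ρ₀ * (W.conjTranspose * A * W)).trace := by
    intro A
    rw [mul_assoc, mul_assoc, Matrix.trace_mul_comm]
    simp only [mul_assoc]
  have h : (W * ρ₀ * W.conjTranspose * (Z j * Z k)).trace = 0 := by
    rw [hφ, conj_mul hW, hρ₀.trace_mul_mul hjk (hN j _) (hN k _), ← hφ]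
    change (W * ρ₀ * W.conjTranspose * Z j).trace * _ = 0
    rw [hZ, trace_mul_diagonal_spin hcomm, zero_mul]
  have h' := congrArg Complex.re h
  rw [hZ, hZ, Matrix.diagonal_mul_diagonal] at h'
  rw [← trace_mul_diagonal]
  simpa using h'

/-- The variance of a signed sum of the spins in the output. -/
lemma IsProductState.output_variance_le {W ρ₀ : Operator V}
    (hW : W ∈ Matrix.unitaryGroup (V → Fin 2) ℂ) (hρ₀ : IsProductState ρ₀)
    (hflip : Commute ρ₀ (flipAll V))
    (hWflip : Commute W (flipAll V)) {c : ℕ} (hs : Spreads W c) (ε : V → Fin 2) :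
    ∑ x, ((W * ρ₀ * W.conjTranspose) x x).re * (∑ v, spin (x v + ε v)) ^ 2 ≤
      Fintype.card V * (c : ℝ) ^ 2 := by
  classical
  obtain ⟨N, hN, hc, hd⟩ := hs
  set p : (V → Fin 2) → ℝ := fun x => ((W * ρ₀ * W.conjTranspose) x x).re with hp
  have hp0 : ∀ x, 0 ≤ p x := hρ₀.output_nonneg W
  have hp1 : ∑ x, p x = 1 := hρ₀.sum_output hW
  have hpair : ∀ j k, ∑ x, p x * (spin (x j + ε j) * spin (x k + ε k)) ≤
      if Disjoint (N j) (N k) then 0 else 1 := by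
    intro j k
    split_ifs with hjk
    · have := hρ₀.trace_output_mul hW hflip hWflip hN hjk
      refine le_of_eq ?_
      calc ∑ x, p x * (spin (x j + ε j) * spin (x k + ε k))
          = (∑ x, p x * (spin (x j) * spin (x k))) * (spin (ε j) * spin (ε k)) := by
            rw [Finset.sum_mul]
            refine Finset.sum_congr rfl fun x _ => ?_
            rw [spin_add, spin_add]
            ring
        _ = 0 := by rw [this, zero_mul]
    · rw [← hp1]
      refine Finset.sum_le_sum fun x _ => mul_le_of_le_one_right (hp0 x) ?_
      refine (le_abs_self _).trans ?_
      rw [abs_mul, abs_spin, abs_spin, one_mul]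
  calc ∑ x, p x * (∑ v, spin (x v + ε v)) ^ 2
      = ∑ j, ∑ k, ∑ x, p x * (spin (x j + ε j) * spin (x k + ε k)) := by
        have : ∀ x, p x * (∑ v, spin (x v + ε v)) ^ 2 =
            ∑ j, ∑ k, p x * (spin (x j + ε j) * spin (x k + ε k)) := fun x => by
          rw [sq, Finset.sum_mul_sum, Finset.mul_sum]
          simp only [Finset.mul_sum]
        simp only [this]
        rw [Finset.sum_comm]
        exact Finset.sum_congr rfl fun j _ => Finset.sum_comm
    _ ≤ ∑ j : V, ∑ k : V, if Disjoint (N j) (N k) then (0 : ℝ) else 1 :=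
        Finset.sum_le_sum fun j _ => Finset.sum_le_sum fun k _ => hpair j k
    _ ≤ ∑ j : V, (c : ℝ) ^ 2 := by
        refine Finset.sum_le_sum fun j _ => ?_
        -- The cone of `k` meets that of `j` only through one of at most `c` points of `N j`, and
        -- each such point lies in at most `c` cones.
        have hsub : (Finset.univ.filter fun k => ¬ Disjoint (N j) (N k)) ⊆
            (N j).biUnion fun w => Finset.univ.filter fun k => w ∈ N k := by
          intro k
          simp [Finset.not_disjoint_iff]
        have hcard := (Finset.card_le_card hsub).trans
          ((Finset.card_biUnion_le_card_mul _ _ _ fun w _ => hd w).trans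
            (Nat.mul_le_mul_right c (hc j)))
        have heq : ∑ k : V, (if Disjoint (N j) (N k) then (0 : ℝ) else 1) =
            ((Finset.univ.filter fun k => ¬ Disjoint (N j) (N k)).card : ℝ) := by
          rw [← Finset.sum_boole]
          exact Finset.sum_congr rfl fun k _ => (ite_not _ _ _).symm
        rw [heq, sq]
        exact_mod_cast hcard
    _ = Fintype.card V * (c : ℝ) ^ 2 := by simp

/-! ### Cuts of bipartite regular graphs -/

section Cut

variable (G : SimpleGraph V) [DecidableRel G.Adj]

omit [DecidableEq V] in
lemma sum_spin (y : V → Fin 2) :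
    ∑ v, spin (y v) = (Fintype.card V : ℝ) - 2 * hammingNorm y := by
  have : ∀ v, spin (y v) = 1 - 2 * if y v ≠ 0 then 1 else 0 := by
    intro v
    by_cases h : y v = 0 <;> (simp [spin, h]; try norm_num)
  simp only [this, Finset.sum_sub_distrib, ← Finset.mul_sum, Finset.sum_boole, hammingNorm]
  simp

omit [DecidableEq V] in
lemma cut_le (x : V → Fin 2) : cut G x ≤ G.edgeFinset.card := Finset.card_filter_le _ _

omit [DecidableEq V] in
-- Adding a proper 2-colouring toggles whether each edge is cut.
lemma cut_add_cut {ε : V → Fin 2} (hε : ∀ u v, G.Adj u v → ε u ≠ ε v) (x : V → Fin 2) :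
    cut G x + cut G (x + ε) = G.edgeFinset.card := by
  have : (G.edgeFinset.filter fun e => ¬ (e.map (x + ε)).IsDiag) =
      G.edgeFinset.filter fun e => (e.map x).IsDiag := by
    refine Finset.filter_congr fun e he => ?_
    induction e using Sym2.ind with
    | _ u v =>
      have h := hε u v (by simpa using he)
      simp only [Sym2.map_mk, Sym2.mk_isDiag_iff, Pi.add_apply]
      revert h
      generalize ε u = a, ε v = b, x u = c, x v = d
      decide +revert
  rw [cut, cut, this, add_comm]
  exact Finset.card_filter_add_card_filter_not _

lemma maxCut_eq {ε : V → Fin 2} (hε : ∀ u v, G.Adj u v → ε u ≠ ε v) :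
    maxCut G = G.edgeFinset.card := by
  refine le_antisymm (Finset.sup_le fun x _ => cut_le G x) ?_
  have h0 : cut G 0 = 0 := by
    rw [cut, Finset.card_eq_zero, Finset.filter_eq_empty_iff]
    intro e _
    induction e using Sym2.ind with
    | _ u v => simp
  have := cut_add_cut G hε 0
  rw [h0, zero_add, zero_add] at this
  rw [← this]
  exact Finset.le_sup (Finset.mem_univ ε)

omit [DecidableEq V] in
lemma two_mul_card_edgeFinset {D : ℕ} (hreg : G.IsRegularOfDegree D) :
    2 * G.edgeFinset.card = Fintype.card V * D := by
  rw [← G.sum_degrees_eq_twice_card_edges]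
  simp [hreg.degree_eq]

variable {G} in
/-- A distribution on cuts with large mean has a large variance of the distance to the bipartition,
unless the graph fails to expand. -/
lemma variance_ge_of_energy {D : ℕ} (hD : 1 ≤ D) (hreg : G.IsRegularOfDegree D)
    {ε : V → Fin 2} (hε : ∀ u v, G.Adj u v → ε u ≠ ε v)
    (hpos : 0 < (D : ℝ) / 2 - √((D : ℝ) - 1))
    (hexp : ∀ x : V → Fin 2, ((D : ℝ) / 2 - √((D : ℝ) - 1)) *
      min (hammingNorm x : ℝ) ((Fintype.card V : ℝ) - hammingNorm x) ≤ cut G x)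
    {p : (V → Fin 2) → ℝ} (hp0 : ∀ x, 0 ≤ p x) (hp1 : ∑ x, p x = 1)
    (hE : (maxCut G : ℝ) * (5 / 6 + √((D : ℝ) - 1) / (3 * D)) ≤ ∑ x, p x * cut G x) :
    4 / 9 * (Fintype.card V : ℝ) ^ 2 ≤ ∑ x, p x * (∑ v, spin (x v + ε v)) ^ 2 := by
  set n : ℝ := (Fintype.card V : ℝ) with hn
  set h : ℝ := (D : ℝ) / 2 - √((D : ℝ) - 1) with hh
  set S : (V → Fin 2) → ℝ := fun x => ∑ v, spin (x v + ε v) with hS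
  have hD0 : (0 : ℝ) < D := by exact_mod_cast hD
  have hmax : (maxCut G : ℝ) = n * D / 2 := by
    rw [maxCut_eq G hε, hn]
    have := two_mul_card_edgeFinset G hreg
    have : (2 : ℝ) * G.edgeFinset.card = Fintype.card V * D := by exact_mod_cast this
    linarith
  have hcut : ∀ x, h * ((n - |S x|) / 2) ≤ maxCut G - cut G x := by
    intro x
    have h1 := hexp (x + ε)
    have h2 : S x = n - 2 * hammingNorm (x + ε) := sum_spin (x + ε)
    have h3 : (cut G x : ℝ) + cut G (x + ε) = maxCut G := by
      rw [maxCut_eq G hε]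
      exact_mod_cast cut_add_cut G hε x
    have h4 : (n - |S x|) / 2 ≤ min (hammingNorm (x + ε) : ℝ) (n - hammingNorm (x + ε)) := by
      rw [h2, le_min_iff]
      constructor
      · linarith [le_abs_self (n - 2 * hammingNorm (x + ε))]
      · linarith [neg_le_abs (n - 2 * hammingNorm (x + ε))]
    linarith [mul_le_mul_of_nonneg_left h4 hpos.le]
  have hmean : h * ((n - ∑ x, p x * |S x|) / 2) ≤ maxCut G - ∑ x, p x * cut G x := by
    have := Finset.sum_le_sum fun x (_ : x ∈ Finset.univ) => mul_le_mul_of_nonneg_left (hcut x) (hp0 x)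
    have e1 : ∑ x, p x * (h * ((n - |S x|) / 2)) = h * ((n - ∑ x, p x * |S x|) / 2) := by
      have : ∀ x, p x * (h * ((n - |S x|) / 2)) = h / 2 * n * p x - h / 2 * (p x * |S x|) :=
        fun x => by ring
      simp only [this, Finset.sum_sub_distrib, ← Finset.mul_sum, hp1]
      ring
    have e2 : ∑ x, p x * ((maxCut G : ℝ) - cut G x) = maxCut G - ∑ x, p x * cut G x := by
      simp only [mul_sub, Finset.sum_sub_distrib, ← Finset.sum_mul, hp1, one_mul]
    rwa [e1, e2] at this
  have habs : 2 * n / 3 ≤ ∑ x, p x * |S x| := by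
    -- The threshold is chosen so that the permitted deficit, with `maxCut G = n * D / 2`, is
    -- exactly `h * n / 6`.
    have e : (maxCut G : ℝ) - maxCut G * (5 / 6 + √((D : ℝ) - 1) / (3 * D)) = h * (n / 6) := by
      rw [hmax, hh]
      field_simp
      ring
    have : h * ((n - ∑ x, p x * |S x|) / 2) ≤ h * (n / 6) := by linarith
    linarith [le_of_mul_le_mul_left this hpos]
  -- Expanding the square around `2n/3` replaces Jensen's inequality.
  have hsq : 0 ≤ ∑ x, p x * (|S x| - 2 * n / 3) ^ 2 :=
    Finset.sum_nonneg fun x _ => mul_nonneg (hp0 x) (sq_nonneg _)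
  have e3 : ∑ x, p x * (|S x| - 2 * n / 3) ^ 2 =
      ∑ x, p x * S x ^ 2 - 4 * n / 3 * ∑ x, p x * |S x| + (2 * n / 3) ^ 2 := by
    have : ∀ x, p x * (|S x| - 2 * n / 3) ^ 2 =
        p x * S x ^ 2 - 4 * n / 3 * (p x * |S x|) + (2 * n / 3) ^ 2 * p x := by
      intro x
      rw [← sq_abs (S x)]
      ring
    simp only [this, Finset.sum_add_distrib, Finset.sum_sub_distrib, ← Finset.mul_sum, hp1, mul_one]
  have hn0 : 0 ≤ 4 * n / 3 := by positivity
  rw [e3] at hsq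
  nlinarith [mul_le_mul_of_nonneg_left habs hn0]

end Cut

/-! ### QAOA layers -/

lemma exp_mem_unitaryGroup {A : Operator V} (hA : A.conjTranspose = -A) :
    NormedSpace.exp A ∈ Matrix.unitaryGroup (V → Fin 2) ℂ := by
  rw [Matrix.mem_unitaryGroup_iff, Matrix.star_eq_conjTranspose, ← Matrix.exp_conjTranspose, hA,
    ← Matrix.exp_add_of_commute _ _ (Commute.refl A).neg_right, add_neg_cancel,
    NormedSpace.exp_zero]

lemma exp_I_smul_mem_unitaryGroup {H : Operator V} (hH : H.IsHermitian) (t : ℝ) :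
    NormedSpace.exp ((Complex.I * (t : ℂ)) • H) ∈ Matrix.unitaryGroup (V → Fin 2) ℂ := by
  refine exp_mem_unitaryGroup ?_
  rw [Matrix.conjTranspose_smul, hH.eq, ← neg_smul]
  simp

/-- A finite-dimensional subalgebra is closed, so it contains the limit of the exponential series.
-/
lemma exp_mem_localAlgebra {S : Finset V} {A : Operator V} (hA : A ∈ localAlgebra S) :
    NormedSpace.exp A ∈ localAlgebra S :=
  NormedSpace.exp_mem (R := ℂ) (s := localAlgebra S)
    (Submodule.closed_of_finiteDimensional (Subalgebra.toSubmodule (localAlgebra S))) hA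

/-- Time evolution under a Hamiltonian with commuting local terms spreads only to the qubits that
share a term. -/
lemma spreads_exp {H : Operator V} {c : ℕ} (t : ℝ) {N : V → Finset V}
    (hN : ∀ v, ∃ R K : Operator V, H = R + K ∧ R.IsHermitian ∧ R ∈ localAlgebra {v}ᶜ ∧
      Commute R K ∧ K ∈ localAlgebra (N v))
    (hself : ∀ v, v ∈ N v) (hcard : ∀ v, (N v).card ≤ c)
    (hsymm : ∀ v w, w ∈ N v → v ∈ N w) :
    Spreads (NormedSpace.exp ((Complex.I * (t : ℂ)) • H)) c := by
  refine ⟨N, fun v B => ?_, hcard, fun w => ?_⟩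
  · obtain ⟨R, K, rfl, hR, hRv, hRK, hK⟩ := hN v
    have hRB : Commute R (onQubit v B) := commute_of_disjoint
      (Finset.disjoint_singleton_right.2 (by simp)) hRv (onQubit_mem (Finset.mem_singleton_self v) B)
    -- Since `R` and `K` commute, the evolution factors; the factor of `R` commutes with the
    -- observable and drops out, leaving only the terms that touch `v`.
    rw [smul_add, Matrix.exp_add_of_commute _ _ ((hRK.smul_left _).smul_right _),
      conj_mul_of_commute (exp_I_smul_mem_unitaryGroup hR t) (hRB.smul_left _).exp_left]
    have hG := exp_mem_localAlgebra (Subalgebra.smul_mem _ hK (Complex.I * (t : ℂ)))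
    exact mul_mem (mul_mem (conjTranspose_mem hG) (onQubit_mem (hself v) B)) hG
  · exact (Finset.card_le_card fun v hv => hsymm v w (Finset.mem_filter.1 hv).2).trans (hcard w)

lemma isHermitian_onQubit_pauliX (v : V) : (onQubit v pauliX).IsHermitian := by
  rw [Matrix.IsHermitian, onQubit, conjTranspose_tensorProd]
  congr 1
  ext1 w
  by_cases hw : w = v
  · subst hw
    rw [Function.update_self]
    ext i j
    fin_cases i <;> fin_cases j <;> simp [pauliX]
  · rw [Function.update_of_ne hw, Matrix.conjTranspose_one]

lemma isHermitian_sum_onQubit_pauliX (s : Finset V) :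
    (-∑ v ∈ s, onQubit v pauliX).IsHermitian := by
  rw [Matrix.IsHermitian, Matrix.conjTranspose_neg, Matrix.conjTranspose_sum]
  simp only [(isHermitian_onQubit_pauliX _).eq]

lemma spreads_mixer (t : ℝ) : Spreads (NormedSpace.exp ((Complex.I * (t : ℂ)) • mixer V)) 1 := by
  refine spreads_exp t (N := fun v => {v}) (fun v => ?_) (by simp) (by simp) (by simp [eq_comm])
  have hR : -∑ w ∈ {v}ᶜ, onQubit w pauliX ∈ localAlgebra ({v}ᶜ : Finset V) :=
    neg_mem (sum_mem fun w hw => onQubit_mem hw _)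
  have hK : -onQubit v pauliX ∈ localAlgebra {v} :=
    neg_mem (onQubit_mem (Finset.mem_singleton_self v) _)
  refine ⟨_, _, ?_, isHermitian_sum_onQubit_pauliX _, hR,
    commute_of_disjoint (Finset.disjoint_singleton_right.2 (by simp)) hR hK, hK⟩
  rw [mixer, ← Finset.sum_compl_add_sum {v}, Finset.sum_singleton, neg_add]

omit [DecidableEq V] in
lemma isHermitian_diagonal_natCast (f : (V → Fin 2) → ℕ) :
    (-Matrix.diagonal fun x => (f x : ℂ)).IsHermitian := by
  refine Matrix.IsHermitian.neg (Matrix.isHermitian_diagonal_of_self_adjoint _ ?_)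
  ext x
  simp

section Graph

variable (G : SimpleGraph V) [DecidableRel G.Adj]

lemma spreads_maxCutHamiltonian {D : ℕ} (hreg : G.IsRegularOfDegree D) (t : ℝ) :
    Spreads (NormedSpace.exp ((Complex.I * (t : ℂ)) • (-maxCutHamiltonian G))) (D + 1) := by
  refine spreads_exp t (N := fun v => insert v (G.neighborFinset v)) (fun v => ?_) (by simp)
    (fun v => ?_) (fun v w => ?_)
  · let R : (V → Fin 2) → ℕ := fun x =>
      ((G.edgeFinset.filter fun e => ¬ (e.map x).IsDiag).filter fun e => v ∉ e).card
    let K : (V → Fin 2) → ℕ := fun x =>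
      ((G.edgeFinset.filter fun e => ¬ (e.map x).IsDiag).filter fun e => v ∈ e).card
    have hcut : ∀ x, cut G x = R x + K x := fun x => by
      rw [add_comm]
      exact (Finset.card_filter_add_card_filter_not _).symm
    refine ⟨-Matrix.diagonal fun x => (R x : ℂ), -Matrix.diagonal fun x => (K x : ℂ), ?_,
      isHermitian_diagonal_natCast R, neg_mem (diagonal_mem fun x y hxy => ?_), ?_,
      neg_mem (diagonal_mem fun x y hxy => ?_)⟩
    · rw [maxCutHamiltonian, ← neg_add, Matrix.diagonal_add]
      simp only [hcut, Nat.cast_add]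
    · refine congrArg Nat.cast (congrArg Finset.card ?_)
      rw [Finset.filter_filter, Finset.filter_filter]
      refine Finset.filter_congr fun e _ => and_congr_left fun hv => ?_
      rw [Sym2.map_congr fun w hw => hxy w (by
        rw [Finset.mem_compl, Finset.mem_singleton]; rintro rfl; exact hv hw)]
    · refine (Commute.neg_left ?_).neg_right
      rw [Commute, SemiconjBy, Matrix.diagonal_mul_diagonal, Matrix.diagonal_mul_diagonal]
      simp only [mul_comm]
    · refine congrArg Nat.cast (congrArg Finset.card ?_)
      rw [Finset.filter_filter, Finset.filter_filter]
      refine Finset.filter_congr fun e he => and_congr_left fun hv => ?_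
      obtain ⟨u, rfl⟩ := hv
      rw [Sym2.map_congr fun w hw => hxy w ?_]
      rw [SimpleGraph.mem_edgeFinset, SimpleGraph.mem_edgeSet] at he
      rcases Sym2.mem_iff.1 hw with rfl | rfl <;> simp [he]
  · exact (Finset.card_insert_le _ _).trans (by rw [G.card_neighborFinset_eq_degree, hreg.degree_eq])
  · simp only [Finset.mem_insert, SimpleGraph.mem_neighborFinset]
    exact fun h => h.imp Eq.symm fun h => h.symm

lemma onQubit_pauliX_commute_flipAll (v : V) : Commute (onQubit v pauliX) (flipAll V) := by
  refine tensorProd_commute fun w => ?_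
  by_cases hw : w = v
  · subst hw; rw [Function.update_self]
  · rw [Function.update_of_ne hw]; exact Commute.one_left _

lemma mixer_commute_flipAll : Commute (mixer V) (flipAll V) :=
  (Commute.sum_left _ _ _ fun v _ => onQubit_pauliX_commute_flipAll v).neg_left

/-- The flip connects only complementary strings, and complementary strings cut the same edges. -/
lemma maxCutHamiltonian_commute_flipAll : Commute (maxCutHamiltonian G) (flipAll V) := by
  ext x y
  rw [maxCutHamiltonian, Matrix.diagonal_mul, Matrix.mul_diagonal, mul_comm]
  by_cases h : ∃ v, x v = y v
  · obtain ⟨v, hv⟩ := h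
    have : flipAll V x y = 0 := by
      refine Finset.prod_eq_zero (Finset.mem_univ v) ?_
      rw [hv]
      generalize y v = b
      fin_cases b <;> simp [pauliX]
    rw [this, zero_mul, zero_mul]
  · push Not at h
    suffices hc : cut G x = cut G y by rw [hc]
    refine congrArg Finset.card (Finset.filter_congr fun e _ => ?_)
    induction e using Sym2.ind with
    | _ u w =>
      have hu := h u
      have hw := h w
      simp only [Sym2.map_mk, Sym2.mk_isDiag_iff]
      revert hu hw
      generalize x u = a, y u = b, x w = c, y w = d
      decide +revert

end Graph

omit [DecidableEq V] in
lemma isProductState_plusState : IsProductState (plusState V) := by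
  refine ⟨_, fun _ => ⟨?_, ?_⟩, rfl⟩
  · have h : (!![1 / 2, 1 / 2; 1 / 2, 1 / 2] : Matrix (Fin 2) (Fin 2) ℂ) =
        (!![1 / 2, 1 / 2; 1 / 2, 1 / 2] : Matrix (Fin 2) (Fin 2) ℂ).conjTranspose *
          !![1 / 2, 1 / 2; 1 / 2, 1 / 2] := by
      ext i j
      fin_cases i <;> fin_cases j <;> simp [Matrix.mul_apply, map_ofNat] <;> norm_num
    rw [h]
    exact Matrix.posSemidef_conjTranspose_mul_self _
  · simp [Matrix.trace]
    norm_num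

lemma plusState_commute_flipAll : Commute (plusState V) (flipAll V) := by
  refine tensorProd_commute fun _ => ?_
  ext i j
  fin_cases i <;> fin_cases j <;> simp [Matrix.mul_apply, pauliX]

/-! ### Circuits -/

lemma spreads_list_prod {c : ℕ} {l : List (Operator V)}
    (hU : ∀ W ∈ l, W ∈ Matrix.unitaryGroup (V → Fin 2) ℂ) (hl : ∀ W ∈ l, Spreads W c) :
    Spreads l.prod (c ^ l.length) := by
  induction l with
  | nil => exact Spreads.one
  | cons W l ih =>
    rw [List.forall_mem_cons] at hU hl
    rw [List.prod_cons, List.length_cons, pow_succ']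
    exact hl.1.mul (list_prod_mem hU.2) (ih hU.2 hl.2)

lemma circuitOutput_eq (layers : List (UnitaryLayer V)) (ρ : Operator V) :
    circuitOutput layers ρ = (layers.reverse.map UnitaryLayer.toOperator).prod * ρ *
      (layers.reverse.map UnitaryLayer.toOperator).prod.conjTranspose := by
  induction layers generalizing ρ with
  | nil => simp [circuitOutput]
  | cons ℓ layers ih =>
    rw [circuitOutput, List.foldl_cons, ← circuitOutput, ih]
    simp [Matrix.conjTranspose_mul, mul_assoc]

/-- A symmetric product state that evolves to a state of large cut must have spread over
a constant fraction of the square root of the number of qubits. -/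
lemma card_le_of_spreads {G : SimpleGraph V} [DecidableRel G.Adj] {D : ℕ} (hD : 1 ≤ D)
    (hreg : G.IsRegularOfDegree D) (hbip : G.IsBipartite)
    (hpos : 0 < (D : ℝ) / 2 - √((D : ℝ) - 1))
    (hexp : ∀ x : V → Fin 2, ((D : ℝ) / 2 - √((D : ℝ) - 1)) *
      min (hammingNorm x : ℝ) ((Fintype.card V : ℝ) - hammingNorm x) ≤ cut G x)
    {W ρ₀ : Operator V} (hW : W ∈ Matrix.unitaryGroup (V → Fin 2) ℂ) (hρ₀ : IsProductState ρ₀)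
    (hflip : Commute ρ₀ (flipAll V)) (hWflip : Commute W (flipAll V)) {c : ℕ} (hs : Spreads W c)
    (hE : (maxCut G : ℝ) * (5 / 6 + √((D : ℝ) - 1) / (3 * D)) ≤
      (W * ρ₀ * W.conjTranspose * maxCutHamiltonian G).trace.re) :
    (Fintype.card V : ℝ) ≤ 9 / 4 * (c : ℝ) ^ 2 := by
  obtain ⟨ε⟩ := hbip
  have hH : maxCutHamiltonian G = Matrix.diagonal fun x => (((cut G x : ℕ) : ℝ) : ℂ) := by
    simp [maxCutHamiltonian]
  rw [hH, trace_mul_diagonal] at hE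
  have h1 := variance_ge_of_energy hD hreg (ε := ε) (fun u v h => ε.valid h) hpos hexp
    (hρ₀.output_nonneg W) (hρ₀.sum_output hW) hE
  have h2 := hρ₀.output_variance_le hW hflip hWflip hs ε
  -- A factor `n` is about to be cancelled, so the empty graph is treated separately.
  rcases (Nat.cast_nonneg (α := ℝ) (Fintype.card V)).eq_or_lt with h0 | h0
  · rw [← h0]; positivity
  · refine le_of_mul_le_mul_left ?_ h0
    linarith

/-- The constant 576 leaves ample room, as `9/4` would already suffice. For `n = 0` the convention
`Real.log 0 = 0` makes the bound hold. -/
lemma log_div_le_of_le {n c : ℝ} {P : ℕ} (hn : 0 ≤ n) (h : n ≤ 9 / 4 * (c ^ P) ^ 2) (hc : 1 ≤ c) :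
    Real.log (n / 576) ≤ 2 * P * Real.log c := by
  rcases hn.eq_or_lt with rfl | hn
  · have := Real.log_nonneg hc
    simp only [zero_div, Real.log_zero]
    positivity
  · calc Real.log (n / 576) ≤ Real.log (c ^ (2 * P)) := by
          refine Real.log_le_log (by positivity) ?_
          rw [mul_comm, pow_mul]
          have : 0 ≤ (c ^ P) ^ 2 := sq_nonneg _
          linarith
      _ = 2 * P * Real.log c := by rw [Real.log_pow]; push_cast; ring

end QMaxCut

end

theorem mainTheorem1 {V : Type*} [Fintype V] [DecidableEq V]
    (G : SimpleGraph V) [DecidableRel G.Adj] (n D : ℕ) (hn : Fintype.card V = n) (hD : 1 ≤ D)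
    (hreg : G.IsRegularOfDegree D) (hbip : G.IsBipartite)
    (hpos : 0 < (D : ℝ) / 2 - √((D : ℝ) - 1))
    (hexp : ∀ x : V → Fin 2,
      ((D : ℝ) / 2 - √((D : ℝ) - 1)) * min (hammingNorm x : ℝ) ((n : ℝ) - hammingNorm x)
        ≤ QMaxCut.cut G x) :
    (∀ (ρ₀ : QMaxCut.Operator V) (layers : List (QMaxCut.UnitaryLayer V)) (L : ℕ),
      layers.length = L →
      QMaxCut.IsProductState ρ₀ →
      Commute ρ₀ (QMaxCut.flipAll V) →
      (∀ ℓ ∈ layers, ∀ e ∈ ℓ.supports, e.card = 2) →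
      (∀ ℓ ∈ layers, ∀ e ∈ ℓ.supports, Commute (ℓ.gateOperator e) (QMaxCut.flipAll V)) →
      (QMaxCut.maxCut G : ℝ) * (5 / 6 + √((D : ℝ) - 1) / (3 * D))
        ≤ (QMaxCut.circuitOutput layers ρ₀ * QMaxCut.maxCutHamiltonian G).trace.re →
      1 / 2 * Real.logb 2 ((n : ℝ) / 576) ≤ (L : ℝ)) ∧
    (∀ (P : ℕ) (γ β : Fin P → ℝ),
      (QMaxCut.maxCut G : ℝ) * (5 / 6 + √((D : ℝ) - 1) / (3 * D))
        ≤ (QMaxCut.qaoaOutput G γ β * QMaxCut.maxCutHamiltonian G).trace.re →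
      1 / (2 * Real.log ((D : ℝ) + 1)) * Real.log ((n : ℝ) / 576) ≤ (P : ℝ)) := by
  open QMaxCut in
  subst hn
  refine ⟨fun ρ₀ layers L hL hρ₀ hflip hcard hgate hE => ?_, fun P γ β hE => ?_⟩
  · have hU : ∀ W ∈ layers.reverse.map UnitaryLayer.toOperator,
        W ∈ Matrix.unitaryGroup (V → Fin 2) ℂ := by
      simp only [List.mem_map, List.mem_reverse]
      rintro _ ⟨ℓ, _, rfl⟩
      exact ℓ.toOperator_mem
    have hs : ∀ W ∈ layers.reverse.map UnitaryLayer.toOperator, Spreads W 2 := by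
      simp only [List.mem_map, List.mem_reverse]
      rintro _ ⟨ℓ, hℓ, rfl⟩
      exact ℓ.spreads one_le_two fun e he => (hcard ℓ hℓ e he).le
    have hF : ∀ W ∈ layers.reverse.map UnitaryLayer.toOperator, Commute (flipAll V) W := by
      simp only [List.mem_map, List.mem_reverse]
      rintro _ ⟨ℓ, hℓ, rfl⟩
      exact (ℓ.toOperator_commute (hgate ℓ hℓ)).symm
    rw [circuitOutput_eq] at hE
    have h := card_le_of_spreads hD hreg hbip hpos hexp (list_prod_mem hU) hρ₀ hflip
      (Commute.list_prod_right _ _ hF).symm (spreads_list_prod hU hs) hE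
    rw [List.length_map, List.length_reverse, hL, Nat.cast_pow] at h
    have hlog := log_div_le_of_le (Nat.cast_nonneg _) h (by norm_num)
    have h2 : 0 < Real.log 2 := Real.log_pos one_lt_two
    rw [Real.logb, ← mul_div_assoc, div_le_iff₀ h2]
    push_cast at hlog
    linarith
  · have hU : ∀ k, NormedSpace.exp ((Complex.I * (β k : ℂ)) • mixer V) *
        NormedSpace.exp ((Complex.I * (γ k : ℂ)) • (-maxCutHamiltonian G)) ∈
          Matrix.unitaryGroup (V → Fin 2) ℂ := fun k =>
      mul_mem (exp_I_smul_mem_unitaryGroup (isHermitian_sum_onQubit_pauliX _) _)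
        (exp_I_smul_mem_unitaryGroup (isHermitian_diagonal_natCast _) _)
    have h := card_le_of_spreads (W := qaoaUnitary G γ β) (c := (D + 1) ^ P) hD hreg hbip hpos hexp
      (list_prod_mem ?_) isProductState_plusState plusState_commute_flipAll
      (Commute.list_prod_right _ _ ?_).symm ?_ hE
    · have hlog := log_div_le_of_le (c := (D : ℝ) + 1) (P := P) (Nat.cast_nonneg _)
        (by exact_mod_cast h) (by simp)
      have hD0 : (0 : ℝ) < D := by exact_mod_cast hD
      have h2 : 0 < Real.log ((D : ℝ) + 1) := Real.log_pos (by linarith)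
      rw [one_div, inv_mul_le_iff₀ (by positivity)]
      linarith
    · rw [List.forall_mem_ofFn_iff]
      exact hU
    · rw [List.forall_mem_ofFn_iff]
      exact fun k => ((mixer_commute_flipAll.smul_left _).exp_left.mul_left
        ((maxCutHamiltonian_commute_flipAll G).neg_left.smul_left _).exp_left).symm
    · have := spreads_list_prod (c := D + 1)
        (l := List.ofFn fun k => NormedSpace.exp ((Complex.I * (β k : ℂ)) • mixer V) *
          NormedSpace.exp ((Complex.I * (γ k : ℂ)) • (-maxCutHamiltonian G)))
        (List.forall_mem_ofFn_iff.2 hU) (List.forall_mem_ofFn_iff.2 fun k => ?_)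
      · rwa [List.length_ofFn] at this
      -- The mixer spreads nothing, so one QAOA step has the light cone of its cost evolution alone.
      · have := (spreads_mixer (V := V) (β k)).mul
          (exp_I_smul_mem_unitaryGroup (isHermitian_diagonal_natCast _) _)
          (spreads_maxCutHamiltonian G hreg (γ k))
        rwa [one_mul] at this
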